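/- Let $V$ be a finite set with $n\ge 4$ elements and let $E$ be the index set of $n-3$ hyperedges, each of which is a $4$-element subset of $V$; write $\mathcal T=(V,E)$ for this 4-uniform hypergraph. For distinct points $z_1,z_2,z_3,z_4\in\mathbb P^1=\mathbb P^1(\mathbb C)$ put $$\mathrm{CR}(z_1,z_2,z_3,z_4)=\frac{(z_3-z_1)(z_4-z_2)}{(z_3-z_2)(z_4-z_1)}\in\mathbb C\setminus\{0,1\},$$ extended as usual when one of the points is $\infty$. Let $M_{0,V}$ be the variety of families $(z_v)_{v\in V}$ of distinct points of $\mathbb P^1$ up to Möbius transformations. Choose an ordering $(v_{e,1},v_{e,2},v_{e,3},v_{e,4})$ of each hyperedge $e$, and let $\mathrm{CR}_{\mathcal T}:M_{0,V}\to(\mathbb C\setminus\{0,1\})^{E}$ be the map with components $\mathrm{CR}(z_{v_{e,1}},z_{v_{e,2}},z_{v_{e,3}},z_{v_{e,4}})$. The cross-ratio degree $d_{\mathcal T}$ is the degree of $\mathrm{CR}_{\mathcal T}$, i.e. the number of points of $\mathrm{CR}_{\mathcal T}^{-1}(a)$ for a general $a\in(\mathbb C\setminus\{0,1\})^E$ (it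 is $0$ if $\mathrm{CR}_{\mathcal T}$ is not dominant). Let $v_1,v_2,v_3\in V$ be distinct, and let $\mathcal T'$ be the hypergraph with vertex set $V'=V\sqcup\{n+1\}$, where $n+1$ is a new vertex, whose hyperedges are those of $\mathcal T$ together with one new hyperedge $e'=\{v_1,v_2,v_3,n+1\}$. Then, whichever orderings of the hyperedges of $\mathcal T$ and of $\mathcal T'$ are chosen, $$d_{\mathcal T}=d_{\mathcal T'}.$$ -/

import Mathlib

open scoped LinearAlgebra.Projectivization MatrixGroups

namespace CrossRatioDegree

/-- The complex projective line `ℙ¹`. -/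
abbrev P1 : Type := ℙ ℂ (Fin 2 → ℂ)

/-- The bracket `x₀ y₁ - x₁ y₀`; for `x = (z, 1)` and `y = (w, 1)` it is `z - w`. -/
def bracket (x y : Fin 2 → ℂ) : ℂ := x 0 * y 1 - x 1 * y 0

/-- The cross-ratio `((z₃ - z₁) (z₄ - z₂)) / ((z₃ - z₂) (z₄ - z₁))` of four points of `ℙ¹`,
written in homogeneous coordinates, so that the point at infinity needs no special treatment.
It is used for distinct points only. -/
noncomputable def crossRatio (z₁ z₂ z₃ z₄ : P1) : ℂ :=
  (bracket z₃.rep z₁.rep * bracket z₄.rep z₂.rep) /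
    (bracket z₃.rep z₂.rep * bracket z₄.rep z₁.rep)

/-- `ℂ ∖ {0, 1}`. -/
abbrev CC : Type := {c : ℂ // c ≠ 0 ∧ c ≠ 1}

/-- The cross-ratio does not depend on the homogeneous coordinates chosen. -/
theorem crossRatio_mk (x₁ x₂ x₃ x₄ : Fin 2 → ℂ)
    (h₁ : x₁ ≠ 0) (h₂ : x₂ ≠ 0) (h₃ : x₃ ≠ 0) (h₄ : x₄ ≠ 0) :
    crossRatio (Projectivization.mk ℂ x₁ h₁) (Projectivization.mk ℂ x₂ h₂)
      (Projectivization.mk ℂ x₃ h₃) (Projectivization.mk ℂ x₄ h₄) =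
    (bracket x₃ x₁ * bracket x₄ x₂) / (bracket x₃ x₂ * bracket x₄ x₁) := by
  obtain ⟨a₁, e₁⟩ := Projectivization.exists_smul_eq_mk_rep ℂ x₁ h₁
  obtain ⟨a₂, e₂⟩ := Projectivization.exists_smul_eq_mk_rep ℂ x₂ h₂
  obtain ⟨a₃, e₃⟩ := Projectivization.exists_smul_eq_mk_rep ℂ x₃ h₃
  obtain ⟨a₄, e₄⟩ := Projectivization.exists_smul_eq_mk_rep ℂ x₄ h₄
  have key : ∀ (a b : ℂˣ) (x y : Fin 2 → ℂ),
      bracket (a • x) (b • y) = (a * b : ℂ) * bracket x y := by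
    intro a b x y
    simp only [bracket, Pi.smul_apply, Units.smul_def, smul_eq_mul]
    ring
  rw [crossRatio, ← e₁, ← e₂, ← e₃, ← e₄, key, key, key, key]
  have hc : (a₁ * a₂ * a₃ * a₄ : ℂ) ≠ 0 := by simp
  rw [← mul_div_mul_left (bracket x₃ x₁ * bracket x₄ x₂) _ hc]
  congr 1 <;> ring

theorem bracket_rep_ne_zero {z w : P1} (h : z ≠ w) : bracket z.rep w.rep ≠ 0 := by
  intro h0
  apply h
  rw [← z.mk_rep, ← w.mk_rep, Projectivization.mk_eq_mk_iff']
  have h0' : z.rep 0 * w.rep 1 = z.rep 1 * w.rep 0 := sub_eq_zero.mp h0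
  by_cases hw : w.rep 0 = 0
  · have hw1 : w.rep 1 ≠ 0 := by
      intro h1
      apply w.rep_nonzero
      ext i
      fin_cases i <;> simp [hw, h1]
    have hz : z.rep 0 = 0 := by
      rw [hw, mul_zero] at h0'
      exact (mul_eq_zero.mp h0').resolve_right hw1
    refine ⟨z.rep 1 / w.rep 1, ?_⟩
    ext i
    fin_cases i
    · simp [hw, hz]
    · simp [hw1]
  · refine ⟨z.rep 0 / w.rep 0, ?_⟩
    ext i
    fin_cases i
    · simp [hw]
    · simp only [Fin.mk_one, Pi.smul_apply, smul_eq_mul]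
      rw [div_mul_eq_mul_div, h0', mul_div_assoc, div_self hw, mul_one]

/-- The cross-ratio of four distinct points lies in `ℂ ∖ {0, 1}`. -/
theorem crossRatio_mem (z : Fin 4 ↪ P1) :
    crossRatio (z 0) (z 1) (z 2) (z 3) ≠ 0 ∧ crossRatio (z 0) (z 1) (z 2) (z 3) ≠ 1 := by
  have hb : ∀ i j : Fin 4, i ≠ j → bracket (z i).rep (z j).rep ≠ 0 :=
    fun i j h => bracket_rep_ne_zero (fun h' => h (z.injective h'))
  have h20 := hb 2 0 (by decide)
  have h31 := hb 3 1 (by decide)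
  have h21 := hb 2 1 (by decide)
  have h30 := hb 3 0 (by decide)
  refine ⟨div_ne_zero (mul_ne_zero h20 h31) (mul_ne_zero h21 h30), fun h => ?_⟩
  rw [crossRatio, div_eq_one_iff_eq (mul_ne_zero h21 h30)] at h
  refine mul_ne_zero (hb 1 0 (by decide)) (hb 3 2 (by decide)) ?_
  simp only [bracket] at h ⊢
  linear_combination h

/-- The cross-ratio is invariant under Möbius transformations. -/
theorem crossRatio_smul (g : GL (Fin 2) ℂ) (z₁ z₂ z₃ z₄ : P1) :
    crossRatio (g • z₁) (g • z₂) (g • z₃) (g • z₄) = crossRatio z₁ z₂ z₃ z₄ := by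
  induction z₁ using Projectivization.ind with | h x₁ h₁ => ?_
  induction z₂ using Projectivization.ind with | h x₂ h₂ => ?_
  induction z₃ using Projectivization.ind with | h x₃ h₃ => ?_
  induction z₄ using Projectivization.ind with | h x₄ h₄ => ?_
  have key : ∀ x y : Fin 2 → ℂ, bracket (g • x) (g • y) = g.val.det * bracket x y := by
    intro x y
    have hs : ∀ w : Fin 2 → ℂ, g • w = g.val.mulVec w := fun _ => rfl
    simp only [bracket, hs, Matrix.mulVec, dotProduct, Fin.sum_univ_two, Matrix.det_fin_two]
    ring
  simp only [Projectivization.smul_mk]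
  rw [crossRatio_mk, crossRatio_mk, key, key, key, key]
  have hg : g.val.det ≠ 0 := g.isUnit.map Matrix.detMonoidHom |>.ne_zero
  rw [← mul_div_mul_left (bracket x₃ x₁ * bracket x₄ x₂) _ (mul_ne_zero hg hg)]
  congr 1 <;> ring

/-- The (complex points of the) moduli space `M_{0,V}`: families of distinct points of `ℙ¹`
indexed by `V`, up to Möbius transformations. -/
abbrev M0 (V : Type*) : Type _ := MulAction.orbitRel.Quotient (GL (Fin 2) ℂ) (V ↪ P1)

/-- The map `CR_T : M_{0,V} → (ℂ ∖ {0, 1})^E` of a family `T` of ordered 4-tuples of distinct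
elements of `V`. -/
noncomputable def crossRatioMap {V E : Type*} (T : E → (Fin 4 ↪ V)) : M0 V → (E → CC) :=
  Quotient.lift
    (fun z e => ⟨crossRatio (z (T e 0)) (z (T e 1)) (z (T e 2)) (z (T e 3)),
      crossRatio_mem ((T e).trans z)⟩)
    (by
      rintro _ z ⟨g, rfl⟩
      funext e
      exact Subtype.ext (crossRatio_smul g _ _ _ _))

/-- `d` is the degree of `CR_T`: the fibre over a general point of `(ℂ ∖ {0, 1})^E`, that is, over
each point of some nonempty Zariski-open subset, has exactly `d` points. (If `CR_T` is not
dominant, the general fibre is empty and `d = 0`.) -/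
def IsDegree {V E : Type*} (T : E → (Fin 4 ↪ V)) (d : ℕ) : Prop :=
  ∃ p : MvPolynomial E ℂ, p ≠ 0 ∧
    ∀ a : E → CC, MvPolynomial.eval (fun e => (a e : ℂ)) p ≠ 0 →
      {x : M0 V | crossRatioMap T x = a}.encard = d

/-- The degree is unique: two nonempty Zariski-open subsets of `(ℂ ∖ {0, 1})^E` meet. -/
theorem IsDegree.unique {V E : Type*} [Fintype E] {T : E → (Fin 4 ↪ V)} {d d' : ℕ}
    (h : IsDegree T d) (h' : IsDegree T d') : d = d' := by
  obtain ⟨p, hp, hd⟩ := h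
  obtain ⟨q, hq, hd'⟩ := h'
  have hX : ∀ c : ℂ, ∀ e : E, (MvPolynomial.X e - MvPolynomial.C c : MvPolynomial E ℂ) ≠ 0 := by
    intro c e h0
    have h1 := congrArg (MvPolynomial.eval (fun _ => c + 1)) h0
    simp at h1
  have hr : p * q * ∏ e : E, ((MvPolynomial.X e - MvPolynomial.C 0) *
      (MvPolynomial.X e - MvPolynomial.C 1)) ≠ 0 :=
    mul_ne_zero (mul_ne_zero hp hq)
      (Finset.prod_ne_zero_iff.mpr fun e _ => mul_ne_zero (hX 0 e) (hX 1 e))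
  obtain ⟨a, ha⟩ : ∃ a : E → ℂ, MvPolynomial.eval a (p * q * ∏ e : E,
      ((MvPolynomial.X e - MvPolynomial.C 0) * (MvPolynomial.X e - MvPolynomial.C 1))) ≠ 0 := by
    by_contra hcon
    push Not at hcon
    exact hr (MvPolynomial.funext fun a => by rw [hcon a, map_zero])
  rw [map_mul, map_mul, map_prod, mul_ne_zero_iff, mul_ne_zero_iff, Finset.prod_ne_zero_iff] at ha
  have hc : ∀ e, a e ≠ 0 ∧ a e ≠ 1 := by
    intro e
    have he := ha.2 e (Finset.mem_univ e)
    simp only [map_mul, map_sub, MvPolynomial.eval_X, MvPolynomial.eval_C, sub_zero] at he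
    exact ⟨left_ne_zero_of_mul he, sub_ne_zero.mp (right_ne_zero_of_mul he)⟩
  have e1 := hd (fun e => ⟨a e, hc e⟩) ha.1.1
  have e2 := hd' (fun e => ⟨a e, hc e⟩) ha.1.2
  exact_mod_cast e1.symm.trans e2

open Classical in
/-- The cross-ratio degree `d_T`: the number of points in a general fibre of `CR_T`. When
`|V| = |E| + 3` is finite, source and target are irreducible varieties of the same dimension, so a
general fibre is finite of constant cardinality and the alternative `0` below never occurs. -/
noncomputable def crossRatioDegree {V E : Type*} (T : E → (Fin 4 ↪ V)) : ℕ :=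
  if h : ∃ d, IsDegree T d then h.choose else 0

end CrossRatioDegree

/-! Forgetting the new point maps the fibre of the extended map over `(a, b)` to the fibre of the
original map over `a`. It is injective because a point of `ℙ¹` is determined by its cross-ratio with
three fixed distinct points (`forget_injOn_fibre`). It is surjective unless the point `u` with
prescribed cross-ratio `b` collides with an old one. Collision with `v₁`, `v₂`, `v₃` is excluded by
`b ≠ 0, 1`. Collision with another `v` makes `(a, b)` a value of `|V| - 2` cross-ratios on
`M_{0,V}`, which has dimension `|V| - 3`; these are algebraically dependent, so `(a, b)` lies on a
fixed hypersurface (`exists_collision_polynomial`). Off it the two fibres have equal cardinality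
(`encard_fibre_extend`). Orderings are harmless: permuting four points acts on their cross-ratio by
a fractional linear bijection of `ℂ ∖ {0, 1}`, which preserves genericity (`IsDegree.reorder`). -/

namespace CrossRatioDegree

open MvPolynomial

/-! ### Clearing denominators and algebraic dependence of rational functions. -/

section Denominators

variable {R : Type*} [CommRing R] [Algebra ℂ R] {ι : Type*} [Fintype ι]

/-- Clearing denominators in `P (N / D)`, uniformly over all field-valued points at which the
denominators `D i` do not vanish. -/
theorem exists_clear_denominators (N D : ι → R) (P : MvPolynomial ι ℂ) :
    ∃ (k : ℕ) (r : R), ∀ (L : Type) [Field L] [Algebra ℂ L] (f : R →ₐ[ℂ] L),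
      (∀ i, f (D i) ≠ 0) →
        f r = (∏ i, f (D i)) ^ k * aeval (fun i => f (N i) / f (D i)) P := by
  classical
  induction P using MvPolynomial.induction_on with
  | C a => exact ⟨0, algebraMap ℂ R a, fun L _ _ f _ => by simp⟩
  | add p q hp hq =>
    obtain ⟨k, r, hr⟩ := hp
    obtain ⟨l, s, hs⟩ := hq
    refine ⟨k + l, (∏ i, D i) ^ l * r + (∏ i, D i) ^ k * s, fun L _ _ f hf => ?_⟩
    simp only [map_add, map_mul, map_pow, map_prod, hr L f hf, hs L f hf]
    ring
  | mul_X p i hp =>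
    obtain ⟨k, r, hr⟩ := hp
    refine ⟨k + 1, N i * (∏ j ∈ Finset.univ.erase i, D j) * r, fun L _ _ f hf => ?_⟩
    simp only [map_mul, map_prod, hr L f hf, aeval_X, pow_succ]
    rw [← Finset.mul_prod_erase Finset.univ (fun j => f (D j)) (Finset.mem_univ i)]
    field_simp [hf i]

end Denominators

theorem trdeg_fractionRing_mvPolynomial (m : ℕ) :
    Algebra.trdeg ℂ (FractionRing (MvPolynomial (Fin m) ℂ)) = m := by
  have := IsLocalization.isAlgebraic (S := FractionRing (MvPolynomial (Fin m) ℂ))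
    (nonZeroDivisors (MvPolynomial (Fin m) ℂ))
  rw [← trdeg_add_eq ℂ (MvPolynomial (Fin m) ℂ), MvPolynomial.trdeg_of_isDomain,
    trdeg_eq_zero]
  simp

/-- More rational functions than variables satisfy a nontrivial polynomial relation. -/
theorem exists_relation_of_card_lt {m : ℕ} {ι : Type*} [Fintype ι] (h : m < Fintype.card ι)
    (N D : ι → MvPolynomial (Fin m) ℂ) :
    ∃ P : MvPolynomial ι ℂ, P ≠ 0 ∧ ∀ t : Fin m → ℂ, (∀ i, eval t (D i) ≠ 0) →
      eval (fun i => eval t (N i) / eval t (D i)) P = 0 := by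
  by_cases hD : ∀ i, D i ≠ 0
  swap
  · push Not at hD
    obtain ⟨i, hi⟩ := hD
    exact ⟨1, one_ne_zero, fun t ht => absurd (by rw [hi, map_zero]) (ht i)⟩
  let K := FractionRing (MvPolynomial (Fin m) ℂ)
  let x : ι → K := fun i => algebraMap _ K (N i) / algebraMap _ K (D i)
  have hx : ¬ AlgebraicIndependent ℂ x := by
    intro hx
    have := hx.lift_cardinalMk_le_trdeg
    rw [trdeg_fractionRing_mvPolynomial] at this
    simp only [Cardinal.mk_fintype, Cardinal.lift_natCast, Nat.cast_le] at this
    omega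
  rw [algebraicIndependent_iff] at hx
  push Not at hx
  obtain ⟨P, hP, hP0⟩ := hx
  refine ⟨P, hP0, fun t ht => ?_⟩
  -- One `r` serves two fields: mapped into `K` it is seen to be zero, and evaluated at `t` it then
  -- forces `P` to vanish.
  obtain ⟨k, r, hr⟩ := exists_clear_denominators N D P
  have hr0 : r = 0 := by
    have h1 := hr K (Algebra.algHom ℂ (MvPolynomial (Fin m) ℂ) K) fun i => by
      change algebraMap _ K (D i) ≠ 0
      simpa [K] using hD i
    have h2 : algebraMap _ K r = 0 := h1.trans (mul_eq_zero_of_right _ hP)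
    simpa [K] using h2
  have h3 := hr ℂ (aeval t) (by simpa [aeval_eq_eval] using ht)
  rw [hr0, map_zero, eq_comm, mul_eq_zero] at h3
  have h4 := h3.resolve_left (pow_ne_zero _ (Finset.prod_ne_zero_iff.mpr
    fun i _ => by simpa [aeval_eq_eval] using ht i))
  simpa [aeval_eq_eval] using h4

/-- A nonzero polynomial does not vanish at some point all of whose coordinates avoid `0`, `1`. -/
theorem exists_eval_ne_zero {ι : Type*} [Fintype ι] {p : MvPolynomial ι ℂ} (hp : p ≠ 0) :
    ∃ a : ι → CC, eval (fun i => (a i : ℂ)) p ≠ 0 := by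
  have hX : ∀ c : ℂ, ∀ e : ι, (X e - C c : MvPolynomial ι ℂ) ≠ 0 := by
    intro c e h0
    have h1 := congrArg (eval (fun _ => c + 1)) h0
    simp at h1
  have hr : p * ∏ e : ι, ((X e - C 0) * (X e - C 1)) ≠ 0 :=
    mul_ne_zero hp (Finset.prod_ne_zero_iff.mpr fun e _ => mul_ne_zero (hX 0 e) (hX 1 e))
  obtain ⟨a, ha⟩ : ∃ a : ι → ℂ, eval a (p * ∏ e : ι, ((X e - C 0) * (X e - C 1))) ≠ 0 := by
    by_contra hcon
    push Not at hcon
    exact hr (MvPolynomial.funext fun a => by rw [hcon a, map_zero])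
  rw [map_mul, map_prod, mul_ne_zero_iff, Finset.prod_ne_zero_iff] at ha
  have hc : ∀ e, a e ≠ 0 ∧ a e ≠ 1 := by
    intro e
    have he := ha.2 e (Finset.mem_univ e)
    simp only [map_mul, map_sub, eval_X, eval_C, sub_zero] at he
    exact ⟨left_ne_zero_of_mul he, sub_ne_zero.mp (right_ne_zero_of_mul he)⟩
  exact ⟨fun e => ⟨a e, hc e⟩, ha.1⟩

/-! ### Reordering hyperedges. -/

/-- A self-map of `ℂ ∖ {0, 1}` given by a fractional linear expression. -/
def IsFractionalLinear (f : CC → CC) : Prop :=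
  ∃ α β γ δ : ℂ, ∀ c : CC, γ * c + δ ≠ 0 ∧ (f c : ℂ) = (α * c + β) / (γ * c + δ)

theorem IsFractionalLinear.comp {f g : CC → CC} (hf : IsFractionalLinear f)
    (hg : IsFractionalLinear g) : IsFractionalLinear (f ∘ g) := by
  obtain ⟨α, β, γ, δ, hf⟩ := hf
  obtain ⟨α', β', γ', δ', hg⟩ := hg
  refine ⟨α * α' + β * γ', α * β' + β * δ', γ * α' + δ * γ', γ * β' + δ * δ', fun c => ?_⟩
  obtain ⟨h1, h2⟩ := hf (g c)
  obtain ⟨h3, h4⟩ := hg c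
  have e1 : (γ * α' + δ * γ') * (c : ℂ) + (γ * β' + δ * δ') =
      (γ * g c + δ) * (γ' * c + δ') := by
    rw [h4]; field_simp; ring
  have e2 : (α * α' + β * γ') * (c : ℂ) + (α * β' + β * δ') =
      (α * g c + β) * (γ' * c + δ') := by
    rw [h4]; field_simp; ring
  refine ⟨e1 ▸ mul_ne_zero h1 h3, ?_⟩
  rw [e1, e2, mul_div_mul_right _ _ h3]
  exact h2

/-- Coordinatewise fractional linear bijections pull back dense open sets to dense open sets. -/
theorem exists_polynomial_pullback {ι : Type*} [Fintype ι] (Φ : ι → Equiv.Perm CC)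
    (hΦ : ∀ i, IsFractionalLinear (Φ i)) {p : MvPolynomial ι ℂ} (hp : p ≠ 0) :
    ∃ q : MvPolynomial ι ℂ, q ≠ 0 ∧ ∀ a : ι → CC, eval (fun i => (a i : ℂ)) q ≠ 0 →
      eval (fun i => (Φ i (a i) : ℂ)) p ≠ 0 := by
  choose α β γ δ h using hΦ
  obtain ⟨k, r, hr⟩ := exists_clear_denominators (fun i => C (α i) * X i + C (β i))
    (fun i => C (γ i) * X i + C (δ i)) p
  have key : ∀ a : ι → CC, eval (fun i => (a i : ℂ)) r =
      (∏ i, (γ i * a i + δ i)) ^ k * eval (fun i => (Φ i (a i) : ℂ)) p := by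
    intro a
    have := hr ℂ (aeval fun i => (a i : ℂ)) (fun i => by simpa using (h i (a i)).1)
    simpa [aeval_eq_eval, ← (h _ (a _)).2] using this
  refine ⟨r, fun hr0 => ?_, fun a ha => right_ne_zero_of_mul (key a ▸ ha)⟩
  obtain ⟨a, ha⟩ := exists_eval_ne_zero hp
  -- Surjectivity of `Φ` is what keeps `r` nonzero: a point where `p` does not vanish has a
  -- preimage.
  have := key fun i => (Φ i).symm (a i)
  rw [hr0, map_zero, eq_comm, mul_eq_zero] at this
  refine this.elim (pow_ne_zero _ (Finset.prod_ne_zero_iff.mpr fun i _ => (h i _).1)) ?_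
  simpa using ha

/-- The cross-ratio of an ordered quadruple of distinct points. -/
noncomputable def quadCrossRatio (z : Fin 4 ↪ P1) : CC :=
  ⟨crossRatio (z 0) (z 1) (z 2) (z 3), crossRatio_mem z⟩

/-- `c ↦ c⁻¹` on `ℂ ∖ {0, 1}`. -/
noncomputable def invPerm : Equiv.Perm CC :=
  Function.Involutive.toPerm
    (fun c => ⟨(c : ℂ)⁻¹, inv_ne_zero c.2.1, fun h => c.2.2 (by simpa using h)⟩)
    fun c => Subtype.ext (inv_inv _)

/-- `c ↦ 1 - c` on `ℂ ∖ {0, 1}`. -/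
noncomputable def oneSubPerm : Equiv.Perm CC :=
  Function.Involutive.toPerm (fun c => ⟨1 - (c : ℂ), fun h => c.2.2 (sub_eq_zero.mp h).symm,
    fun h => c.2.1 (by simpa using h)⟩) fun c => Subtype.ext (sub_sub_cancel _ _)

theorem isFractionalLinear_invPerm : IsFractionalLinear invPerm :=
  ⟨0, 1, 1, 0, fun c => ⟨by simpa using c.2.1, (show (c : ℂ)⁻¹ = _ by simp)⟩⟩

theorem isFractionalLinear_oneSubPerm : IsFractionalLinear oneSubPerm :=
  ⟨-1, 1, 0, 1, fun c => ⟨by simp, (show 1 - (c : ℂ) = _ by simp; ring)⟩⟩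

/-- Reordering four points changes their cross-ratio by a fractional linear bijection that depends
only on the permutation. -/
theorem exists_perm_quadCrossRatio (σ : Equiv.Perm (Fin 4)) :
    ∃ Φ : Equiv.Perm CC, IsFractionalLinear Φ ∧
      ∀ z : Fin 4 ↪ P1, quadCrossRatio (σ.toEmbedding.trans z) = Φ (quadCrossRatio z) := by
  have hσ : σ ∈ Submonoid.closure (Set.range fun i : Fin 3 => Equiv.swap i.castSucc i.succ) := by
    rw [Equiv.Perm.mclosure_swap_castSucc_succ]
    exact Submonoid.mem_top σ
  induction hσ using Submonoid.closure_induction with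
  | one =>
    refine ⟨1, ⟨1, 0, 0, 1, fun c => by simp⟩, fun z => rfl⟩
  | mul σ τ _ _ hσ hτ =>
    obtain ⟨Φ, hΦ, h⟩ := hσ
    obtain ⟨Ψ, hΨ, h'⟩ := hτ
    -- The order reverses since permutations act by precomposition: `z ∘ (σ * τ) = (z ∘ σ) ∘ τ`.
    refine ⟨Ψ * Φ, hΨ.comp hΦ, fun z => ?_⟩
    rw [Equiv.Perm.mul_apply, ← h, ← h']
    rfl
  | mem σ hσ =>
    obtain ⟨i, rfl⟩ := hσ
    fin_cases i
    · refine ⟨invPerm, isFractionalLinear_invPerm, fun z => Subtype.ext ?_⟩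
      change crossRatio (z 1) (z 0) (z 2) (z 3) = (crossRatio (z 0) (z 1) (z 2) (z 3))⁻¹
      rw [crossRatio, crossRatio, inv_div]
    · refine ⟨oneSubPerm, isFractionalLinear_oneSubPerm, fun z => Subtype.ext ?_⟩
      change crossRatio (z 0) (z 2) (z 1) (z 3) = 1 - crossRatio (z 0) (z 1) (z 2) (z 3)
      have hb : ∀ i j : Fin 4, i ≠ j → bracket (z i).rep (z j).rep ≠ 0 :=
        fun i j h => bracket_rep_ne_zero (fun h' => h (z.injective h'))
      have h12 := hb 1 2 (by decide)
      have h21 := hb 2 1 (by decide)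
      have h30 := hb 3 0 (by decide)
      rw [crossRatio, crossRatio, eq_sub_iff_add_eq,
        div_add_div _ _ (mul_ne_zero h12 h30) (mul_ne_zero h21 h30),
        div_eq_one_iff_eq (mul_ne_zero (mul_ne_zero h12 h30) (mul_ne_zero h21 h30))]
      simp only [bracket]
      ring
    · refine ⟨invPerm, isFractionalLinear_invPerm, fun z => Subtype.ext ?_⟩
      change crossRatio (z 0) (z 1) (z 3) (z 2) = (crossRatio (z 0) (z 1) (z 2) (z 3))⁻¹
      rw [crossRatio, crossRatio, inv_div]
      ring

/-- The degree does not depend on the orderings of the hyperedges. -/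
theorem IsDegree.reorder {V E : Type*} [Fintype E] {T T' : E → (Fin 4 ↪ V)} {d : ℕ}
    (hT : ∀ e, Set.range (T e) = Set.range (T' e)) (h : IsDegree T d) : IsDegree T' d := by
  have hσ : ∀ e, ∃ σ : Equiv.Perm (Fin 4), T e = σ.toEmbedding.trans (T' e) := by
    intro e
    have : ∀ i, ∃ j, T' e j = T e i := fun i => by
      have : T e i ∈ Set.range (T' e) := hT e ▸ Set.mem_range_self i
      exact this
    choose s hs using this
    have hinj : Function.Injective s := fun i j hij => (T e).injective (by rw [← hs, ← hs, hij])
    exact ⟨Equiv.ofBijective s (Finite.injective_iff_bijective.mp hinj),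
      DFunLike.ext _ _ fun i => (hs i).symm⟩
  choose σ hσ using hσ
  choose Φ hΦ hΦz using exists_perm_quadCrossRatio
  obtain ⟨p, hp, hd⟩ := h
  obtain ⟨q, hq, hqp⟩ := exists_polynomial_pullback (fun e => Φ (σ e)) (fun e => hΦ _) hp
  refine ⟨q, hq, fun a ha => ?_⟩
  rw [← hd (fun e => Φ (σ e) (a e)) (hqp a ha)]
  congr 1
  ext x
  induction x using Quotient.inductionOn with | h z => ?_
  have h1 : ∀ e, crossRatioMap T (Quotient.mk _ z) e =
      Φ (σ e) (crossRatioMap T' (Quotient.mk _ z) e) := by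
    intro e
    rw [show crossRatioMap T' (Quotient.mk _ z) e = quadCrossRatio ((T' e).trans z) from rfl,
      ← hΦz,
      show crossRatioMap T (Quotient.mk _ z) e = quadCrossRatio ((T e).trans z) from rfl, hσ e]
    rfl
  simp only [Set.mem_ofPred_eq, funext_iff, h1, EmbeddingLike.apply_eq_iff_eq]

/-! ### Normalizing three points to `∞`, `0`, `1`; dependence of cross-ratios. -/

theorem bracket_self (x : Fin 2 → ℂ) : bracket x x = 0 := by
  simp only [bracket]; ring

/-- Homogeneous coordinates, with polynomial entries, of the points `∞`, `0`, `1` and of `m`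
indeterminate points. -/
noncomputable def normalPoint (m : ℕ) : Fin 3 ⊕ Fin m → Fin 2 → MvPolynomial (Fin m) ℂ :=
  Sum.elim ![![1, 0], ![0, 1], ![1, 1]] fun j => ![X j, 1]

/-- Up to a linear change of coordinates and rescaling, a family of distinct points whose first
three members are moved to `∞`, `0`, `1` is a specialization of `normalPoint`. -/
theorem exists_normalization {m : ℕ} (z : Fin 3 ⊕ Fin m ↪ P1) :
    ∃ (t : Fin m → ℂ) (κ : ℂ) (l : Fin 3 ⊕ Fin m → ℂ), κ ≠ 0 ∧ (∀ v, l v ≠ 0) ∧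
      ∀ v w, bracket (fun i => eval t (normalPoint m v i)) (fun i => eval t (normalPoint m w i)) =
        κ * l v * l w * bracket (z v).rep (z w).rep := by
  have hb : ∀ v w, v ≠ w → bracket (z v).rep (z w).rep ≠ 0 :=
    fun v w h => bracket_rep_ne_zero (fun h' => h (z.injective h'))
  set a := (z (.inl 0)).rep with ha
  set b := (z (.inl 1)).rep with hb'
  set c := (z (.inl 2)).rep with hc
  have hab : bracket a b ≠ 0 := hb _ _ (by simp)
  have hba : bracket b a ≠ 0 := hb _ _ (by simp)
  have hca : bracket c a ≠ 0 := hb _ _ (by simp)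
  have hcb : bracket c b ≠ 0 := hb _ _ (by simp)
  have hja : ∀ j, bracket (z (.inr j)).rep a ≠ 0 := fun j => hb _ _ (by simp)
  -- The linear map `x ↦ ([x b] / [c b], [x a] / [c a])` sends `a`, `b`, `c` to multiples of `(1,
  -- 0)`, `(0, 1)`, `(1, 1)`. The scalars `l` make the images exactly normal; `κ` below is the
  -- determinant of the map.
  let l : Fin 3 ⊕ Fin m → ℂ := Sum.elim ![bracket c b / bracket a b, bracket c a / bracket b a, 1]
    fun j => bracket c a / bracket (z (.inr j)).rep a
  let t : Fin m → ℂ := fun j => (bracket (z (.inr j)).rep b / bracket c b) *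
    (bracket c a / bracket (z (.inr j)).rep a)
  have hY : ∀ v, (fun i => eval t (normalPoint m v i)) =
      ![l v * (bracket (z v).rep b / bracket c b), l v * (bracket (z v).rep a / bracket c a)] := by
    intro v
    rcases v with v | j
    · fin_cases v <;> ext i <;> fin_cases i <;>
        simp [normalPoint, l, ← ha, ← hb', ← hc, bracket_self, hab, hba, hca, hcb]
    · ext i
      fin_cases i
      · simp [normalPoint, l, t]; ring
      · simp [normalPoint, l]
        field_simp [hja j]
  refine ⟨t, bracket b a / (bracket c b * bracket c a), l, ?_, ?_, ?_⟩
  · exact div_ne_zero hba (mul_ne_zero hcb hca)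
  · rintro (v | j)
    · fin_cases v
      · exact div_ne_zero hcb hab
      · exact div_ne_zero hca hba
      · exact one_ne_zero
    · exact div_ne_zero hca (hja j)
  · intro v w
    rw [hY, hY]
    have : ∀ x y : Fin 2 → ℂ, bracket x b * bracket y a - bracket x a * bracket y b =
        bracket b a * bracket x y := by
      intro x y; simp only [bracket]; ring
    rw [show bracket b a / (bracket c b * bracket c a) * l v * l w *
        bracket (z v).rep (z w).rep =
        (bracket b a * bracket (z v).rep (z w).rep) * l v * l w /
          (bracket c b * bracket c a) by ring, ← this]
    generalize bracket (z v).rep b = p1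
    generalize bracket (z v).rep a = p2
    generalize bracket (z w).rep b = p3
    generalize bracket (z w).rep a = p4
    simp only [bracket.eq_1 (![_, _])]
    simp
    field_simp

/-- Any family of more than `|V| - 3` cross-ratios on `M_{0,V}` is algebraically dependent. -/
theorem exists_relation_crossRatioMap {V ι : Type*} [Fintype V] [Fintype ι]
    (h3 : 3 ≤ Fintype.card V) (h : Fintype.card V < Fintype.card ι + 3) (T : ι → (Fin 4 ↪ V)) :
    ∃ P : MvPolynomial ι ℂ, P ≠ 0 ∧
      ∀ x : M0 V, eval (fun i => (crossRatioMap T x i : ℂ)) P = 0 := by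
  obtain ⟨m, hm⟩ := Nat.exists_eq_add_of_le h3
  let ε : Fin 3 ⊕ Fin m ≃ V := Fintype.equivOfCardEq (by simp [hm])
  let Y : V → Fin 2 → MvPolynomial (Fin m) ℂ := fun v => normalPoint m (ε.symm v)
  let br : V → V → MvPolynomial (Fin m) ℂ := fun v w => Y v 0 * Y w 1 - Y v 1 * Y w 0
  obtain ⟨P, hP, hPt⟩ := exists_relation_of_card_lt (m := m) (ι := ι) (by omega)
    (fun i => br (T i 2) (T i 0) * br (T i 3) (T i 1))
    (fun i => br (T i 2) (T i 1) * br (T i 3) (T i 0))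
  refine ⟨P, hP, fun x => ?_⟩
  induction x using Quotient.inductionOn with | h z => ?_
  obtain ⟨t, κ, l, hκ, hl, hY⟩ := exists_normalization (ε.toEmbedding.trans z)
  have hbr : ∀ v w, eval t (br v w) =
      κ * l (ε.symm v) * l (ε.symm w) * bracket (z v).rep (z w).rep := by
    intro v w
    have := hY (ε.symm v) (ε.symm w)
    simp only [Function.Embedding.trans_apply, Equiv.coe_toEmbedding, Equiv.apply_symm_apply]
      at this
    rw [← this]
    simp [br, Y, bracket]
  have hb : ∀ i (j k : Fin 4), j ≠ k → bracket (z (T i j)).rep (z (T i k)).rep ≠ 0 :=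
    fun i j k h => bracket_rep_ne_zero fun h' => h ((T i).injective (z.injective h'))
  have hbr0 : ∀ i (j k : Fin 4), j ≠ k → eval t (br (T i j) (T i k)) ≠ 0 := fun i j k h => by
    rw [hbr]
    exact mul_ne_zero (mul_ne_zero (mul_ne_zero hκ (hl _)) (hl _)) (hb i j k h)
  refine Eq.trans ?_ (hPt t fun i => by
    rw [map_mul]
    exact mul_ne_zero (hbr0 i 2 1 (by decide)) (hbr0 i 3 0 (by decide)))
  congr 2
  funext i
  change crossRatio (z (T i 0)) (z (T i 1)) (z (T i 2)) (z (T i 3)) = _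
  have h21 := hb i 2 1 (by decide)
  have h30 := hb i 3 0 (by decide)
  have l0 := hl (ε.symm (T i 0))
  have l1 := hl (ε.symm (T i 1))
  have l2 := hl (ε.symm (T i 2))
  have l3 := hl (ε.symm (T i 3))
  -- Numerator and denominator both carry the factor `κ² l₀ l₁ l₂ l₃`, which cancels.
  simp only [map_mul, hbr, crossRatio]
  field_simp

/-! ### Solving for the fourth point of a cross-ratio. -/

theorem crossRatio_injective_right {z₁ z₂ z₃ u u' : P1} (h₁₂ : z₁ ≠ z₂) (h₁₃ : z₁ ≠ z₃)
    (h₂₃ : z₂ ≠ z₃) (hu : u ≠ z₁) (hu' : u' ≠ z₁)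
    (h : crossRatio z₁ z₂ z₃ u = crossRatio z₁ z₂ z₃ u') : u = u' := by
  by_contra hne
  have b31 := bracket_rep_ne_zero h₁₃.symm
  have b32 := bracket_rep_ne_zero h₂₃.symm
  have bu := bracket_rep_ne_zero hu
  have bu' := bracket_rep_ne_zero hu'
  rw [crossRatio, crossRatio, div_eq_div_iff (mul_ne_zero b32 bu) (mul_ne_zero b32 bu')] at h
  -- By the Plücker relation the cross-multiplied difference factors into brackets.
  have h' : bracket z₃.rep z₁.rep * bracket z₃.rep z₂.rep *
      (bracket u.rep u'.rep * bracket z₁.rep z₂.rep) = 0 := by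
    simp only [bracket] at h ⊢
    linear_combination -h
  exact mul_ne_zero (mul_ne_zero b31 b32)
    (mul_ne_zero (bracket_rep_ne_zero hne) (bracket_rep_ne_zero h₁₂)) h'

theorem exists_crossRatio_eq {z₁ z₂ z₃ : P1} (h₁₂ : z₁ ≠ z₂) (h₁₃ : z₁ ≠ z₃)
    (h₂₃ : z₂ ≠ z₃) (b : ℂ) : ∃ u, crossRatio z₁ z₂ z₃ u = b := by
  have b31 := bracket_rep_ne_zero h₁₃.symm
  have b32 := bracket_rep_ne_zero h₂₃.symm
  have b12 := bracket_rep_ne_zero h₁₂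
  -- The equation `[z₃ z₁] [x z₂] = b [z₃ z₂] [x z₁]` is linear in `x`; this vector spans its
  -- solutions.
  let x : Fin 2 → ℂ := fun i =>
    b * bracket z₃.rep z₂.rep * z₁.rep i - bracket z₃.rep z₁.rep * z₂.rep i
  have hx1 : bracket x z₁.rep = bracket z₃.rep z₁.rep * bracket z₁.rep z₂.rep := by
    simp only [bracket, x]; ring
  have hx2 : bracket x z₂.rep = b * bracket z₃.rep z₂.rep * bracket z₁.rep z₂.rep := by
    simp only [bracket, x]; ring
  have hx : x ≠ 0 := fun h => mul_ne_zero b31 b12 (by rw [← hx1, h]; simp [bracket])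
  refine ⟨Projectivization.mk ℂ x hx, ?_⟩
  rw [← z₁.mk_rep, ← z₂.mk_rep, ← z₃.mk_rep, crossRatio_mk, hx1, hx2]
  field_simp

/-- Forgetting the new point: the map `M_{0,V ⊔ {∗}} → M_{0,V}`. -/
noncomputable def forget {V : Type*} : M0 (Option V) → M0 V :=
  Quotient.map' (fun z => Function.Embedding.some.trans z) (by
    rintro _ z ⟨g, rfl⟩
    exact ⟨g, rfl⟩)

/-! ### Adding a vertex and a hyperedge; comparison of fibres. -/

section Extension

variable {V E : Type*}

/-- The ordered quadruple `(v₁, v₂, v₃, v)`. -/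
def quadruple (v₁ v₂ v₃ v : V) (h₁₂ : v₁ ≠ v₂) (h₁₃ : v₁ ≠ v₃) (h₂₃ : v₂ ≠ v₃)
    (h₁ : v ≠ v₁) (h₂ : v ≠ v₂) (h₃ : v ≠ v₃) : Fin 4 ↪ V where
  toFun := ![v₁, v₂, v₃, v]
  inj' := by
    intro i j
    fin_cases i <;> fin_cases j <;> simp_all [eq_comm]

variable (T : E → (Fin 4 ↪ V)) {v₁ v₂ v₃ : V} (h₁₂ : v₁ ≠ v₂) (h₁₃ : v₁ ≠ v₃) (h₂₃ : v₂ ≠ v₃)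

/-- The hypergraph `T` with the new vertex `none` and the new hyperedge `(v₁, v₂, v₃, none)`. -/
def extend : Option E → (Fin 4 ↪ Option V)
  | some e => (T e).trans Function.Embedding.some
  | none => quadruple (some v₁) (some v₂) (some v₃) none (by simpa) (by simpa) (by simpa)
      (by simp) (by simp) (by simp)

theorem crossRatioMap_extend_some (x : M0 (Option V)) (e : E) :
    crossRatioMap (extend T h₁₂ h₁₃ h₂₃) x (some e) = crossRatioMap T (forget x) e := by
  induction x using Quotient.inductionOn with | h z => rfl

/-- A Möbius map matching the old points preserves the new cross-ratio, hence matches the new points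
too. -/
theorem forget_injOn_fibre (a : Option E → CC) :
    Set.InjOn forget {x : M0 (Option V) | crossRatioMap (extend T h₁₂ h₁₃ h₂₃) x = a} := by
  intro x hx y hy hxy
  induction x using Quotient.inductionOn with | h z => ?_
  induction y using Quotient.inductionOn with | h w => ?_
  obtain ⟨g, hg⟩ := Quotient.exact hxy
  have hg' : ∀ v, g • w (some v) = z (some v) := fun v => DFunLike.congr_fun hg v
  refine Quotient.sound ⟨g, DFunLike.ext _ _ fun v => ?_⟩
  rcases v with _ | v
  swap
  · exact hg' v
  have hz : crossRatio (z (some v₁)) (z (some v₂)) (z (some v₃)) (z none) = a none :=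
    congrArg Subtype.val (congrFun hx none)
  have hw : crossRatio (w (some v₁)) (w (some v₂)) (w (some v₃)) (w none) = a none :=
    congrArg Subtype.val (congrFun hy none)
  rw [← crossRatio_smul g, hg', hg', hg'] at hw
  refine crossRatio_injective_right (z.injective.ne (by simpa)) (z.injective.ne (by simpa))
    (z.injective.ne (by simpa)) ?_ (z.injective.ne (by simp)) (hw.trans hz.symm)
  rw [← hg' v₁]
  exact fun h => w.injective.ne (by simp) (MulAction.injective g h)

/-- The exceptional values of the new cross-ratio, at which the new point collides with an old one,
lie on a hypersurface. -/
theorem exists_collision_polynomial {V E : Type*} [Fintype V] [Fintype E]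
    (T : E → (Fin 4 ↪ V)) {v₁ v₂ v₃ : V} (h₁₂ : v₁ ≠ v₂) (h₁₃ : v₁ ≠ v₃) (h₂₃ : v₂ ≠ v₃)
    (hcard : Fintype.card V = Fintype.card E + 3) :
    ∃ B : MvPolynomial (Option E) ℂ, B ≠ 0 ∧ ∀ (z : V ↪ P1) (v : V), v ≠ v₁ → v ≠ v₂ → v ≠ v₃ →
      eval (fun e => Option.elim e (crossRatio (z v₁) (z v₂) (z v₃) (z v))
        fun e => (crossRatioMap T (Quotient.mk _ z) e : ℂ)) B = 0 := by
  have key : ∀ v : V, ∃ B : MvPolynomial (Option E) ℂ, B ≠ 0 ∧ ∀ z : V ↪ P1,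
      v ≠ v₁ → v ≠ v₂ → v ≠ v₃ →
      eval (fun e => Option.elim e (crossRatio (z v₁) (z v₂) (z v₃) (z v))
        fun e => (crossRatioMap T (Quotient.mk _ z) e : ℂ)) B = 0 := by
    intro v
    by_cases hv : v ≠ v₁ ∧ v ≠ v₂ ∧ v ≠ v₃
    · obtain ⟨h₁, h₂, h₃⟩ := hv
      -- Putting `v` in place of the new vertex gives `|E| + 1 = |V| - 2` cross-ratios on `M_{0,V}`
      -- itself.
      obtain ⟨B, hB, hB0⟩ := exists_relation_crossRatioMap (ι := Option E) (by omega)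
        (by simp; omega)
        (fun e => Option.elim e (quadruple v₁ v₂ v₃ v h₁₂ h₁₃ h₂₃ h₁ h₂ h₃) T)
      refine ⟨B, hB, fun z _ _ _ => ?_⟩
      refine Eq.trans ?_ (hB0 (Quotient.mk _ z))
      congr 2
      funext e
      cases e <;> rfl
    · exact ⟨1, one_ne_zero, fun z h₁ h₂ h₃ => absurd ⟨h₁, h₂, h₃⟩ hv⟩
  choose B hB hB0 using key
  refine ⟨∏ v, B v, Finset.prod_ne_zero_iff.mpr fun v _ => hB v, fun z v h₁ h₂ h₃ => ?_⟩
  rw [map_prod]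
  exact Finset.prod_eq_zero (Finset.mem_univ v) (hB0 v z h₁ h₂ h₃)

/-- Off the collision hypersurface, forgetting the new point identifies the fibres. -/
theorem encard_fibre_extend {B : MvPolynomial (Option E) ℂ}
    (hB : ∀ (z : V ↪ P1) (v : V), v ≠ v₁ → v ≠ v₂ → v ≠ v₃ →
      eval (fun e => Option.elim e (crossRatio (z v₁) (z v₂) (z v₃) (z v))
        fun e => (crossRatioMap T (Quotient.mk _ z) e : ℂ)) B = 0)
    (a : E → CC) (b : CC)
    (hab : eval (fun e => Option.elim e (b : ℂ) fun e => (a e : ℂ)) B ≠ 0) :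
    {x : M0 (Option V) | crossRatioMap (extend T h₁₂ h₁₃ h₂₃) x =
      fun e => Option.elim e b a}.encard = {x : M0 V | crossRatioMap T x = a}.encard := by
  rw [← (forget_injOn_fibre T h₁₂ h₁₃ h₂₃ _).encard_image]
  congr 1
  ext y
  constructor
  · rintro ⟨x, hx, rfl⟩
    funext e
    rw [← crossRatioMap_extend_some T h₁₂ h₁₃ h₂₃]
    exact congrFun hx (some e)
  · intro hy
    induction y using Quotient.inductionOn with | h z => ?_
    have z₁₂ : z v₁ ≠ z v₂ := z.injective.ne h₁₂
    have z₁₃ : z v₁ ≠ z v₃ := z.injective.ne h₁₃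
    have z₂₃ : z v₂ ≠ z v₃ := z.injective.ne h₂₃
    obtain ⟨u, hu⟩ := exists_crossRatio_eq z₁₂ z₁₃ z₂₃ (b : ℂ)
    have hne : ∀ v, z v ≠ u := by
      rintro v rfl
      -- At `v₁` the true cross-ratio is `∞`, but division by zero returns `0`, so `b ≠ 0` rules it
      -- out as it does `v₂`, where the numerator vanishes.
      by_cases h₁ : v = v₁
      · subst h₁
        exact b.2.1 (by rw [← hu, crossRatio, bracket_self]; simp)
      by_cases h₂ : v = v₂
      · subst h₂
        exact b.2.1 (by rw [← hu, crossRatio, bracket_self]; simp)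
      by_cases h₃ : v = v₃
      · subst h₃
        refine b.2.2 ?_
        rw [← hu, crossRatio, mul_comm, div_self]
        exact mul_ne_zero (bracket_rep_ne_zero z₂₃.symm) (bracket_rep_ne_zero z₁₃.symm)
      apply hab
      have := hB z v h₁ h₂ h₃
      rwa [hu, show crossRatioMap T (Quotient.mk _ z) = a from hy] at this
    refine ⟨Quotient.mk _ (z.optionElim u (by rintro ⟨v, hv⟩; exact hne v hv)), ?_, ?_⟩
    · funext e
      cases e with
      | none => exact Subtype.ext hu
      | some e => exact congrFun hy e
    · rfl

theorem isDegree_extend_iff [Fintype V] [Fintype E]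
    (hcard : Fintype.card V = Fintype.card E + 3) (d : ℕ) :
    IsDegree T d ↔ IsDegree (extend T h₁₂ h₁₃ h₂₃) d := by
  obtain ⟨B, hB, hB0⟩ := exists_collision_polynomial T h₁₂ h₁₃ h₂₃ hcard
  constructor
  · rintro ⟨p, hp, hd⟩
    refine ⟨rename some p * B, mul_ne_zero ?_ hB, fun a ha => ?_⟩
    · rwa [Ne, map_eq_zero_iff _ (rename_injective _ (Option.some_injective E))]
    · rw [map_mul, eval_rename] at ha
      have ha' : a = fun e => Option.elim e (a none) fun e => a (some e) := by
        funext e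
        cases e <;> rfl
      rw [← hd (fun e => a (some e)) (left_ne_zero_of_mul ha),
        ← encard_fibre_extend T h₁₂ h₁₃ h₂₃ hB0 (fun e => a (some e)) (a none) ?_, ← ha']
      convert right_ne_zero_of_mul ha using 4 with e
      cases e <;> rfl
  · rintro ⟨q, hq, hd⟩
    -- `q * B` is viewed as a polynomial in the new variable. Where its leading coefficient is
    -- nonzero at `a`, the specialization is nonzero and has a non-root `b ≠ 0, 1`.
    let Q := optionEquivLeft ℂ E (q * B)
    have hQ : Q ≠ 0 := by
      rw [Ne, EmbeddingLike.map_eq_zero_iff]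
      exact mul_ne_zero hq hB
    refine ⟨Q.leadingCoeff, Polynomial.leadingCoeff_ne_zero.mpr hQ, fun a ha => ?_⟩
    let Qa : Polynomial ℂ := Q.map (eval fun e => (a e : ℂ))
    have hQa : Qa * (Polynomial.X * (Polynomial.X - Polynomial.C 1)) ≠ 0 := by
      refine mul_ne_zero (fun h => ha ?_) (mul_ne_zero Polynomial.X_ne_zero
        (Polynomial.X_sub_C_ne_zero 1))
      have := congrArg (fun r => Polynomial.coeff r Q.natDegree) h
      simpa [Qa] using this
    obtain ⟨b, hb⟩ : ∃ b, Polynomial.eval b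
        (Qa * (Polynomial.X * (Polynomial.X - Polynomial.C 1))) ≠ 0 := by
      by_contra! hcon
      exact hQa (Polynomial.funext fun b => by rw [hcon b, Polynomial.eval_zero])
    simp only [Polynomial.eval_mul, Polynomial.eval_sub, Polynomial.eval_X, Polynomial.eval_C,
      mul_ne_zero_iff, sub_ne_zero] at hb
    obtain ⟨hb, hb01⟩ := hb
    rw [← optionEquivLeft_elim_eval, map_mul] at hb
    rw [← encard_fibre_extend T h₁₂ h₁₃ h₂₃ hB0 a ⟨b, hb01⟩ (right_ne_zero_of_mul hb)]
    apply hd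
    convert left_ne_zero_of_mul hb using 4 with e
    cases e <;> rfl

/-- Equal predicates give the same chosen value, so existence of a degree need not be proved. -/
theorem crossRatioDegree_congr {V V' E E' : Type*} {T : E → (Fin 4 ↪ V)}
    {T' : E' → (Fin 4 ↪ V')} (h : ∀ d, IsDegree T d ↔ IsDegree T' d) :
    crossRatioDegree T = crossRatioDegree T' := by
  have h' : IsDegree T = IsDegree T' := funext fun d => propext (h d)
  unfold crossRatioDegree
  rw [h']

end Extension

end CrossRatioDegree

theorem lemma3p2 {V E : Type*} [Fintype V] [Fintype E]
    (hcard : Fintype.card V = Fintype.card E + 3)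
    (T : E → (Fin 4 ↪ V)) (v₁ v₂ v₃ : V) (h₁₂ : v₁ ≠ v₂) (h₁₃ : v₁ ≠ v₃) (h₂₃ : v₂ ≠ v₃)
    (T' : Option E → (Fin 4 ↪ Option V))
    (hold : ∀ e : E, Set.range (T' (some e)) = some '' Set.range (T e))
    (hnew : Set.range (T' none) = {some v₁, some v₂, some v₃, none}) :
    CrossRatioDegree.crossRatioDegree T = CrossRatioDegree.crossRatioDegree T' := by
  have hrange : ∀ e, Set.range (CrossRatioDegree.extend T h₁₂ h₁₃ h₂₃ e) = Set.range (T' e) := by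
    intro e
    cases e with
    | some e =>
      rw [hold, ← Set.range_comp]
      rfl
    | none =>
      rw [hnew]
      change Set.range ![some v₁, some v₂, some v₃, none] = _
      simp only [Matrix.range_cons, Matrix.range_empty, Set.union_empty, Set.singleton_union]
  exact CrossRatioDegree.crossRatioDegree_congr fun d =>
    (CrossRatioDegree.isDegree_extend_iff T h₁₂ h₁₃ h₂₃ hcard d).trans
      ⟨CrossRatioDegree.IsDegree.reorder hrange,
        CrossRatioDegree.IsDegree.reorder fun e => (hrange e).symm⟩
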